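/- Let $H$ be a triangular Hopf algebra over $\mathbb{C}$, i.e. a Hopf algebra with comultiplication $\Delta$, counit $\varepsilon$, antipode $\gamma$ and a universal R-matrix $\mathcal{R}=\mathcal{R}_1\otimes\mathcal{R}_2\in H\otimes H$ (summation suppressed) such that $(\Delta\otimes\mathrm{id})(\mathcal{R})=\mathcal{R}_{13}\mathcal{R}_{23}$, $(\mathrm{id}\otimes\Delta)(\mathcal{R})=\mathcal{R}_{13}\mathcal{R}_{12}$, $\mathcal{R}\Delta(h)=\Delta^{op}(h)\mathcal{R}$ for all $h\in H$, and $\mathcal{R}\mathcal{R}_{21}=1\otimes 1$. Let $\mathrm{Lie}(H)\subset H$ be the set of all $\xi\in H$ with $$\Delta(\xi)=\xi\otimes 1+\mathcal{R}_2\otimes \mathrm{ad}(\mathcal{R}_1)(\xi),\qquad \mathrm{ad}(h)(a):=h^{(1)}a\,\gamma(h^{(2)}).$$ Let $\mathcal{F}=\mathcal{F}_1\otimes\mathcal{F}_2\in H\otimes H$ be a twisting cocycle, i.e. an invertible element with $(\Delta\otimes\mathrm{id})(\mathcal{F})\mathcal{F}_{12}=(\mathrm{id}\otimes\Delta)(\mathcal{F})\mathcal{F}_{23}$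 and $(\varepsilon\otimes\mathrm{id})(\mathcal{F})=1=(\mathrm{id}\otimes\varepsilon)(\mathcal{F})$. Let $\tilde H$ be the twist of $H$ by $\mathcal{F}$: the triangular Hopf algebra with the same multiplication, unit and counit as $H$, and with comultiplication $\tilde\Delta(h)=\mathcal{F}^{-1}\Delta(h)\mathcal{F}$, antipode $\tilde\gamma(h)=\vartheta^{-1}\gamma(h)\vartheta$ where $\vartheta=\gamma(\mathcal{F}_1)\mathcal{F}_2$, and R-matrix $\tilde{\mathcal{R}}=\mathcal{F}_{21}^{-1}\mathcal{R}\mathcal{F}$. If $H$ is generated by $\mathrm{Lie}(H)$ as a (unital) associative algebra, then $\tilde H$ is generated by $\mathrm{Lie}(\tilde H)$ as a (unital) associative algebra. -/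

import Mathlib

open scoped TensorProduct

namespace HopfTwist

universe u v

section Legs

variable {k : Type u} {H : Type v} [CommRing k] [Ring H] [Algebra k H]

/-- The leg embedding `a ⊗ b ↦ a ⊗ b ⊗ 1`. -/
def leg12 : H ⊗[k] H →ₐ[k] H ⊗[k] (H ⊗[k] H) :=
  Algebra.TensorProduct.map (AlgHom.id k H) Algebra.TensorProduct.includeLeft

/-- The leg embedding `a ⊗ b ↦ a ⊗ 1 ⊗ b`. -/
def leg13 : H ⊗[k] H →ₐ[k] H ⊗[k] (H ⊗[k] H) :=
  Algebra.TensorProduct.map (AlgHom.id k H) Algebra.TensorProduct.includeRight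

/-- The leg embedding `a ⊗ b ↦ 1 ⊗ a ⊗ b`. -/
def leg23 : H ⊗[k] H →ₐ[k] H ⊗[k] (H ⊗[k] H) :=
  Algebra.TensorProduct.includeRight

/-- The flip `a ⊗ b ↦ b ⊗ a`, so that `flip X` is `X₂₁`. -/
def flip : H ⊗[k] H →ₐ[k] H ⊗[k] H :=
  (Algebra.TensorProduct.comm k H H : H ⊗[k] H →ₐ[k] H ⊗[k] H)

/-- The map `D ⊗ id`, with values in `H ⊗ (H ⊗ H)`. -/
def onLeft (D : H →ₐ[k] H ⊗[k] H) : H ⊗[k] H →ₐ[k] H ⊗[k] (H ⊗[k] H) :=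
  (Algebra.TensorProduct.assoc k k k H H H).toAlgHom.comp
    (Algebra.TensorProduct.map D (AlgHom.id k H))

/-- The map `id ⊗ D`. -/
def onRight (D : H →ₐ[k] H ⊗[k] H) : H ⊗[k] H →ₐ[k] H ⊗[k] (H ⊗[k] H) :=
  Algebra.TensorProduct.map (AlgHom.id k H) D

/-- The map `e ⊗ id`, under the identification `k ⊗ H ≃ H`. -/
def counitLeft (e : H →ₐ[k] k) : H ⊗[k] H →ₐ[k] H :=
  (Algebra.TensorProduct.lid k H).toAlgHom.comp
    (Algebra.TensorProduct.map e (AlgHom.id k H))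

/-- The map `id ⊗ e`, under the identification `H ⊗ k ≃ H`. -/
def counitRight (e : H →ₐ[k] k) : H ⊗[k] H →ₐ[k] H :=
  (Algebra.TensorProduct.rid k k H).toAlgHom.comp
    (Algebra.TensorProduct.map (AlgHom.id k H) e)

@[simp] lemma leg12_tmul (a b : H) :
    leg12 (a ⊗ₜ[k] b) = a ⊗ₜ[k] (b ⊗ₜ[k] (1 : H)) := by simp [leg12]
@[simp] lemma leg13_tmul (a b : H) :
    leg13 (a ⊗ₜ[k] b) = a ⊗ₜ[k] ((1 : H) ⊗ₜ[k] b) := by simp [leg13]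
@[simp] lemma leg23_tmul (a b : H) :
    leg23 (a ⊗ₜ[k] b) = (1 : H) ⊗ₜ[k] (a ⊗ₜ[k] b) := by simp [leg23]
@[simp] lemma flip_tmul (a b : H) : flip (a ⊗ₜ[k] b) = b ⊗ₜ[k] a := by simp [flip]
@[simp] lemma counitLeft_tmul (e : H →ₐ[k] k) (a b : H) :
    counitLeft e (a ⊗ₜ[k] b) = e a • b := by simp [counitLeft]
@[simp] lemma counitRight_tmul (e : H →ₐ[k] k) (a b : H) :
    counitRight e (a ⊗ₜ[k] b) = e b • a := by simp [counitRight]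
@[simp] lemma onRight_tmul (D : H →ₐ[k] H ⊗[k] H) (a b : H) :
    onRight D (a ⊗ₜ[k] b) = a ⊗ₜ[k] D b := by simp [onRight]
lemma onLeft_tmul (D : H →ₐ[k] H ⊗[k] H) (a b : H) :
    onLeft D (a ⊗ₜ[k] b) = Algebra.TensorProduct.assoc k k k H H H (D a ⊗ₜ[k] b) := by
  simp [onLeft]

@[simp] lemma flip_flip (x : H ⊗[k] H) : flip (flip x) = x := by
  induction x with
  | zero => simp
  | tmul a b => simp
  | add x y hx hy => simp [hx, hy]

end Legs

/-- A triangular Hopf algebra over `k`: a Hopf algebra with a universal R-matrix `R` that satisfies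
`R R₂₁ = 1 ⊗ 1` (which makes `R` invertible). -/
class TriangularHopfAlgebra (k : Type u) (H : Type v) [CommRing k] [Ring H] extends
    HopfAlgebra k H where
  /-- The universal R-matrix. -/
  R : H ⊗[k] H
  /-- `R R₂₁ = 1 ⊗ 1`. -/
  R_mul_flip : R * flip R = 1
  /-- `(Δ ⊗ id)(R) = R₁₃ R₂₃`. -/
  comul_left_R : onLeft (Bialgebra.comulAlgHom k H) R = leg13 R * leg23 R
  /-- `(id ⊗ Δ)(R) = R₁₃ R₁₂`. -/
  comul_right_R : onRight (Bialgebra.comulAlgHom k H) R = leg13 R * leg12 R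
  /-- `R Δ(h) = Δᵒᵖ(h) R`. -/
  R_mul_comul : ∀ h : H,
    R * Bialgebra.comulAlgHom k H h = flip (Bialgebra.comulAlgHom k H h) * R

/-- A twisting cocycle of a Hopf algebra `H`: an invertible `F ∈ H ⊗ H` with
`(Δ ⊗ id)(F) F₁₂ = (id ⊗ Δ)(F) F₂₃` and `(ε ⊗ id)(F) = 1 = (id ⊗ ε)(F)`. -/
structure TwistingCocycle (k : Type u) (H : Type v) [CommRing k] [Ring H]
    [HopfAlgebra k H] where
  /-- The underlying invertible element. -/
  F : (H ⊗[k] H)ˣ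
  cocycle : onLeft (Bialgebra.comulAlgHom k H) F * leg12 (F : H ⊗[k] H) =
    onRight (Bialgebra.comulAlgHom k H) F * leg23 (F : H ⊗[k] H)
  counit_left : counitLeft (Bialgebra.counitAlgHom k H) F = 1
  counit_right : counitRight (Bialgebra.counitAlgHom k H) F = 1

section Adjoint

variable (k : Type u) {H : Type v} [CommRing k] [Ring H] [HopfAlgebra k H]

/-- The bilinear map `(x ⊗ y, c) ↦ γ(x) c y`. -/
noncomputable def actL : H ⊗[k] H →ₗ[k] H →ₗ[k] H :=
  TensorProduct.lift (LinearMap.mk₂ k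
    (fun x y => (LinearMap.mulLeft k (HopfAlgebra.antipode k x)).comp (LinearMap.mulRight k y))
    (by intros; ext; simp [add_mul]) (by intros; ext; simp)
    (by intros; ext; simp [mul_add]) (by intros; ext; simp))

/-- The bilinear map `(x ⊗ y, c) ↦ x c γ(y)`. -/
noncomputable def actR : H ⊗[k] H →ₗ[k] H →ₗ[k] H :=
  TensorProduct.lift (LinearMap.mk₂ k
    (fun x y => (LinearMap.mulLeft k x).comp (LinearMap.mulRight k (HopfAlgebra.antipode k y)))
    (by intros; ext; simp [add_mul]) (by intros; ext; simp)
    (by intros; ext; simp [mul_add]) (by intros; ext; simp))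

/-- The adjoint action `ad(h) a = h⁽¹⁾ a γ(h⁽²⁾)` of a Hopf algebra on itself. -/
noncomputable def ad : H →ₗ[k] H →ₗ[k] H := (actR k).comp Coalgebra.comul

@[simp] lemma actL_tmul (x y c : H) :
    actL k (x ⊗ₜ[k] y) c = HopfAlgebra.antipode k x * (c * y) := by simp [actL]

@[simp] lemma actR_tmul (x y c : H) :
    actR k (x ⊗ₜ[k] y) c = x * (c * HopfAlgebra.antipode k y) := by simp [actR]

end Adjoint

/-- `Lie(H)`: the elements `ξ` with `Δ(ξ) = ξ ⊗ 1 + R₂ ⊗ ad(R₁)(ξ)`. -/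
def LieSet (k : Type u) (H : Type v) [CommRing k] [Ring H] [TriangularHopfAlgebra k H] : Set H :=
  {ξ | (Coalgebra.comul ξ : H ⊗[k] H) = ξ ⊗ₜ[k] (1 : H) +
    flip (LinearMap.rTensor H ((ad k).flip ξ) TriangularHopfAlgebra.R)}

section TwistConstruction

variable {k : Type u} {H : Type v} [CommRing k] [Ring H]

/-- Conjugation `x ↦ F⁻¹ x F` on an algebra. -/
def conj {A : Type*} [Ring A] [Algebra k A] (F : Aˣ) : A →ₐ[k] A where
  toFun x := ↑F⁻¹ * x * F
  map_one' := by simp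
  map_mul' x y := by simp [mul_assoc]
  map_zero' := by simp
  map_add' x y := by simp [mul_add, add_mul]
  commutes' r := by
    rw [← Algebra.commutes r (↑F⁻¹ : A), mul_assoc, Units.inv_mul, mul_one]

lemma conj_apply {A : Type*} [Ring A] [Algebra k A] (F : Aˣ) (x : A) :
    conj (k := k) F x = ↑F⁻¹ * x * F := rfl

variable [HopfAlgebra k H]

local notation "Δ" => Bialgebra.comulAlgHom k H
local notation "ε" => Bialgebra.counitAlgHom k H
local notation "γ" => HopfAlgebra.antipode k (A := H)

namespace TwistingCocycle

/-- The twisted comultiplication `h ↦ F⁻¹ Δ(h) F`. -/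
def comul (F : TwistingCocycle k H) : H →ₐ[k] H ⊗[k] H :=
  (conj F.F).comp Δ

/-- The element `ϑ = γ(F₁) F₂`. -/
noncomputable def theta (F : TwistingCocycle k H) : H :=
  LinearMap.mul' k H (LinearMap.rTensor H γ (F.F : H ⊗[k] H))

/-- The element `F⁻¹₁ γ(F⁻¹₂)`, which is the inverse of `ϑ`. -/
noncomputable def thetaInv (F : TwistingCocycle k H) : H :=
  LinearMap.mul' k H (LinearMap.lTensor H γ ((F.F⁻¹ : (H ⊗[k] H)ˣ) : H ⊗[k] H))

end TwistingCocycle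

lemma actL_one (c : H) : actL k (1 : H ⊗[k] H) c = c := by
  simp [Algebra.TensorProduct.one_def]

lemma actR_one (c : H) : actR k (1 : H ⊗[k] H) c = c := by
  simp [Algebra.TensorProduct.one_def]

lemma actL_mul (X Y : H ⊗[k] H) (c : H) : actL k (X * Y) c = actL k Y (actL k X c) := by
  induction X with
  | zero => simp
  | add X X' h h' => simp [add_mul, h, h']
  | tmul a b =>
    induction Y with
    | zero => simp
    | add Y Y' h h' => simp [mul_add, h, h']
    | tmul x y => simp [HopfAlgebra.antipode_mul_antidistrib, mul_assoc]

lemma actR_mul (X Y : H ⊗[k] H) (c : H) : actR k (X * Y) c = actR k X (actR k Y c) := by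
  induction X with
  | zero => simp
  | add X X' h h' => simp [add_mul, h, h']
  | tmul a b =>
    induction Y with
    | zero => simp
    | add Y Y' h h' => simp only [mul_add, map_add, LinearMap.add_apply, h, h']
    | tmul x y => simp [HopfAlgebra.antipode_mul_antidistrib, mul_assoc]

lemma actL_eq (X : H ⊗[k] H) :
    actL k X 1 = LinearMap.mul' k H (LinearMap.rTensor H γ X) := by
  induction X with
  | zero => simp
  | add X X' h h' => simp [h, h']
  | tmul a b => simp

lemma actR_eq (X : H ⊗[k] H) :
    actR k X 1 = LinearMap.mul' k H (LinearMap.lTensor H γ X) := by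
  induction X with
  | zero => simp
  | add X X' h h' => simp [h, h']
  | tmul a b => simp

lemma actL_comul (h : H) : actL k (Δ h) 1 = algebraMap k H (ε h) := by
  rw [actL_eq]; exact HopfAlgebra.mul_antipode_rTensor_comul_apply h

lemma actR_comul (h : H) : actR k (Δ h) 1 = algebraMap k H (ε h) := by
  rw [actR_eq]; exact HopfAlgebra.mul_antipode_lTensor_comul_apply h

/-- `x ⊗ y ⊗ z ↦ γ(x) y γ(z)`. -/
noncomputable def tripL : H ⊗[k] (H ⊗[k] H) →ₗ[k] H :=
  LinearMap.mul' k H ∘ₗ TensorProduct.map γ (LinearMap.mul' k H ∘ₗ LinearMap.lTensor H γ)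

/-- `x ⊗ y ⊗ z ↦ x γ(y) z`. -/
noncomputable def tripR : H ⊗[k] (H ⊗[k] H) →ₗ[k] H :=
  LinearMap.mul' k H ∘ₗ TensorProduct.map LinearMap.id
    (LinearMap.mul' k H ∘ₗ LinearMap.rTensor H γ)

@[simp] lemma tripL_tmul (x y z : H) : tripL (x ⊗ₜ[k] (y ⊗ₜ[k] z)) = γ x * (y * γ z) := by
  simp [tripL]
@[simp] lemma tripR_tmul (x y z : H) : tripR (x ⊗ₜ[k] (y ⊗ₜ[k] z)) = x * (γ y * z) := by
  simp [tripR]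

lemma tripL_onLeft (T A C : H ⊗[k] H) :
    tripL (onLeft Δ T * leg12 A * leg23 C) =
      actL k A 1 * actR k C 1 * γ (counitLeft ε T) := by
  induction A with
  | zero => simp
  | add A A' h h' => simp only [map_add, add_mul, mul_add, LinearMap.add_apply, TensorProduct.add_tmul, h, h']
  | tmul a b =>
  induction C with
  | zero => simp
  | add A A' h h' => simp only [map_add, add_mul, mul_add, LinearMap.add_apply, TensorProduct.add_tmul, h, h']
  | tmul c d =>
  induction T with
  | zero => simp
  | add A A' h h' => simp only [map_add, add_mul, mul_add, LinearMap.add_apply, TensorProduct.add_tmul, h, h']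
  | tmul x y =>
    have key : ∀ D : H ⊗[k] H,
        tripL (Algebra.TensorProduct.assoc k k k H H H (D ⊗ₜ[k] y) * leg12 (a ⊗ₜ[k] b)
          * leg23 (c ⊗ₜ[k] d)) = γ a * actL k D 1 * (b * c * γ d * γ y) := by
      intro D
      induction D with
      | zero => simp
      | add A A' h h' => simp only [map_add, add_mul, mul_add, LinearMap.add_apply, TensorProduct.add_tmul, h, h']
      | tmul p q => simp [HopfAlgebra.antipode_mul_antidistrib, mul_assoc]
    rw [onLeft_tmul, key, actL_comul]
    simp [Algebra.algebraMap_eq_smul_one, mul_assoc]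

lemma tripL_onRight (T : H ⊗[k] H) :
    tripL (onRight Δ T) = γ (counitRight ε T) := by
  induction T with
  | zero => simp
  | add A A' h h' => simp [h, h']
  | tmul x y =>
    have key : ∀ D : H ⊗[k] H, tripL (x ⊗ₜ[k] D) = γ x * actR k D 1 := by
      intro D
      induction D with
      | zero => simp
      | add A A' h h' => simp [mul_add, TensorProduct.tmul_add, h, h']
      | tmul p q => simp
    rw [onRight_tmul, key, actR_comul]
    simp [Algebra.algebraMap_eq_smul_one]

lemma tripR_onLeft (T A C : H ⊗[k] H) :
    tripR (leg23 A * leg12 C * onLeft Δ T) =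
      actR k C 1 * actL k A 1 * counitLeft ε T := by
  induction A with
  | zero => simp
  | add A A' h h' => simp only [map_add, add_mul, mul_add, LinearMap.add_apply, TensorProduct.add_tmul, h, h']
  | tmul a b =>
  induction C with
  | zero => simp
  | add A A' h h' => simp only [map_add, add_mul, mul_add, LinearMap.add_apply, TensorProduct.add_tmul, h, h']
  | tmul c d =>
  induction T with
  | zero => simp
  | add A A' h h' => simp only [map_add, add_mul, mul_add, LinearMap.add_apply, TensorProduct.add_tmul, h, h']
  | tmul x y =>
    have key : ∀ D : H ⊗[k] H,
        tripR (leg23 (a ⊗ₜ[k] b) * leg12 (c ⊗ₜ[k] d) *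
          Algebra.TensorProduct.assoc k k k H H H (D ⊗ₜ[k] y)) =
          c * actR k D 1 * (γ d * γ a * b * y) := by
      intro D
      induction D with
      | zero => simp
      | add A A' h h' => simp only [map_add, add_mul, mul_add, LinearMap.add_apply, TensorProduct.add_tmul, h, h']
      | tmul p q => simp [HopfAlgebra.antipode_mul_antidistrib, mul_assoc]
    rw [onLeft_tmul, key, actR_comul]
    simp [Algebra.algebraMap_eq_smul_one, mul_assoc]

lemma tripR_onRight (T : H ⊗[k] H) :
    tripR (onRight Δ T) = counitRight ε T := by
  induction T with
  | zero => simp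
  | add A A' h h' => simp [h, h']
  | tmul x y =>
    have key : ∀ D : H ⊗[k] H, tripR (x ⊗ₜ[k] D) = x * actL k D 1 := by
      intro D
      induction D with
      | zero => simp
      | add A A' h h' => simp [mul_add, TensorProduct.tmul_add, h, h']
      | tmul p q => simp
    rw [onRight_tmul, key, actL_comul]
    simp [Algebra.algebraMap_eq_smul_one]

lemma onLeft_conj (D : H →ₐ[k] H ⊗[k] H) (F : (H ⊗[k] H)ˣ) (x : H ⊗[k] H) :
    onLeft ((conj F).comp D) x =
      leg12 ((F⁻¹ : (H ⊗[k] H)ˣ) : H ⊗[k] H) * onLeft D x * leg12 (F : H ⊗[k] H) := by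
  have key : ∀ (X : H ⊗[k] H) (Y : H ⊗[k] H) (Z : H ⊗[k] H) (b : H),
      Algebra.TensorProduct.assoc k k k H H H ((X * Y * Z) ⊗ₜ[k] b) =
        leg12 X * Algebra.TensorProduct.assoc k k k H H H (Y ⊗ₜ[k] b) * leg12 Z := by
    have l : ∀ X : H ⊗[k] H,
        leg12 X = Algebra.TensorProduct.assoc k k k H H H (X ⊗ₜ[k] (1 : H)) := by
      intro X
      induction X with
      | zero => simp
      | add A A' h h' => simp [TensorProduct.add_tmul, h, h']
      | tmul p q => simp
    intro X Y Z b
    rw [l, l, ← map_mul, ← map_mul]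
    simp
  induction x with
  | zero => simp
  | add A A' h h' => simp [mul_add, add_mul, h, h']
  | tmul a b => rw [onLeft_tmul, onLeft_tmul, ← key]; rfl

lemma onRight_conj (D : H →ₐ[k] H ⊗[k] H) (F : (H ⊗[k] H)ˣ) (x : H ⊗[k] H) :
    onRight ((conj F).comp D) x =
      leg23 ((F⁻¹ : (H ⊗[k] H)ˣ) : H ⊗[k] H) * onRight D x * leg23 (F : H ⊗[k] H) := by
  induction x with
  | zero => simp
  | add A A' h h' => simp [mul_add, add_mul, h, h']
  | tmul a b => simp [leg23, conj_apply]

/-- The permutation `a ⊗ b ⊗ c ↦ a ⊗ c ⊗ b`. -/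
def swap23 : H ⊗[k] (H ⊗[k] H) →ₐ[k] H ⊗[k] (H ⊗[k] H) :=
  Algebra.TensorProduct.map (AlgHom.id k H) flip

/-- The permutation `a ⊗ b ⊗ c ↦ b ⊗ c ⊗ a`. -/
def cyc : H ⊗[k] (H ⊗[k] H) →ₐ[k] H ⊗[k] (H ⊗[k] H) :=
  (Algebra.TensorProduct.assoc k k k H H H).toAlgHom.comp
    (Algebra.TensorProduct.comm k H (H ⊗[k] H)).toAlgHom

@[simp] lemma swap23_tmul (a b c : H) :
    swap23 (a ⊗ₜ[k] (b ⊗ₜ[k] c)) = a ⊗ₜ[k] (c ⊗ₜ[k] b) := by simp [swap23]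
@[simp] lemma cyc_tmul (a b c : H) :
    cyc (a ⊗ₜ[k] (b ⊗ₜ[k] c)) = b ⊗ₜ[k] (c ⊗ₜ[k] a) := by simp [cyc]

lemma swap23_leg12 (X : H ⊗[k] H) : swap23 (leg12 X) = leg13 X := by
  induction X with
  | zero => simp
  | add A A' h h' => simp only [map_add, h, h']
  | tmul p q => simp

lemma swap23_leg23 (X : H ⊗[k] H) : swap23 (leg23 X) = leg23 (flip X) := by
  induction X with
  | zero => simp
  | add A A' h h' => simp only [map_add, h, h']
  | tmul p q => simp

lemma swap23_onRight (D : H →ₐ[k] H ⊗[k] H) (X : H ⊗[k] H) :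
    swap23 (onRight D X) = onRight (flip.comp D) X := by
  induction X with
  | zero => simp
  | add A A' h h' => simp only [map_add, h, h']
  | tmul p q => simp [swap23]

lemma cyc_leg12 (X : H ⊗[k] H) : cyc (leg12 X) = leg13 (flip X) := by
  induction X with
  | zero => simp
  | add A A' h h' => simp only [map_add, h, h']
  | tmul p q => simp

lemma cyc_leg13 (X : H ⊗[k] H) : cyc (leg13 X) = leg23 (flip X) := by
  induction X with
  | zero => simp
  | add A A' h h' => simp only [map_add, h, h']
  | tmul p q => simp

lemma cyc_leg23 (X : H ⊗[k] H) : cyc (leg23 X) = leg12 X := by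
  induction X with
  | zero => simp
  | add A A' h h' => simp only [map_add, h, h']
  | tmul p q => simp

lemma cyc_onRight (D : H →ₐ[k] H ⊗[k] H) (X : H ⊗[k] H) :
    cyc (onRight D X) = onLeft D (flip X) := by
  induction X with
  | zero => simp
  | add A A' h h' => simp only [map_add, h, h']
  | tmul p q => rw [flip_tmul, onLeft_tmul]; simp [cyc]

lemma cyc_cyc_onLeft (D : H →ₐ[k] H ⊗[k] H) (X : H ⊗[k] H) :
    cyc (cyc (onLeft D X)) = onRight D (flip X) := by
  induction X with
  | zero => simp
  | add A A' h h' => simp only [map_add, h, h']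
  | tmul p q =>
    rw [flip_tmul, onLeft_tmul, onRight_tmul]
    induction D p with
    | zero => simp
    | add A A' h h' => simp only [map_add, TensorProduct.add_tmul, TensorProduct.tmul_add, h, h']
    | tmul p q => simp

lemma swap23_onLeft_flip (D : H →ₐ[k] H ⊗[k] H) (X : H ⊗[k] H) :
    swap23 (onLeft (flip.comp D) X) = cyc (onLeft D X) := by
  induction X with
  | zero => simp
  | add A A' h h' => simp only [map_add, h, h']
  | tmul p q =>
    rw [onLeft_tmul, onLeft_tmul, AlgHom.comp_apply]
    induction D p with
    | zero => simp
    | add A A' h h' => simp only [map_add, TensorProduct.add_tmul, h, h']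
    | tmul p q => simp

/-- If `R Δ(h) = Δᵒᵖ(h) R` on `H`, then `R₁₂ (Δ ⊗ id)(X) = (Δᵒᵖ ⊗ id)(X) R₁₂`. -/
lemma leg12_mul_onLeft (D : H →ₐ[k] H ⊗[k] H) (R : H ⊗[k] H)
    (hR : ∀ h, R * D h = flip (D h) * R) (X : H ⊗[k] H) :
    leg12 R * onLeft D X = onLeft (flip.comp D) X * leg12 R := by
  have l : ∀ X : H ⊗[k] H,
      leg12 X = Algebra.TensorProduct.assoc k k k H H H (X ⊗ₜ[k] (1 : H)) := by
    intro X
    induction X with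
    | zero => simp
    | add A A' h h' => simp [TensorProduct.add_tmul, h, h']
    | tmul p q => simp
  induction X with
  | zero => simp
  | add A A' h h' => simp only [map_add, mul_add, add_mul, h, h']
  | tmul p q =>
    rw [onLeft_tmul, onLeft_tmul, l, ← map_mul, ← map_mul]
    simp [hR]

lemma leg23_mul_onRight (D : H →ₐ[k] H ⊗[k] H) (R : H ⊗[k] H)
    (hR : ∀ h, R * D h = flip (D h) * R) (X : H ⊗[k] H) :
    leg23 R * onRight D X = onRight (flip.comp D) X * leg23 R := by
  induction X with
  | zero => simp
  | add A A' h h' => simp only [map_add, mul_add, add_mul, h, h']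
  | tmul p q => simp [leg23, hR]

/-- In the presence of `R R₂₁ = 1`, the first hexagon identity gives the second. -/
lemma hexagon_right (D : H →ₐ[k] H ⊗[k] H) (R : H ⊗[k] H) (h1 : R * flip R = 1)
    (h : onLeft D R = leg13 R * leg23 R) : onRight D R = leg13 R * leg12 R := by
  have h2 : flip R * R = 1 := by simpa using congrArg flip h1
  have h3 : onRight D (flip R) = leg12 (flip R) * leg13 (flip R) := by
    rw [← cyc_cyc_onLeft, h]
    simp only [map_mul, cyc_leg13, cyc_leg23, cyc_leg12]
  refine left_inv_eq_right_inv (a := onRight D (flip R)) ?_ ?_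
  · rw [← map_mul, h1, map_one]
  · rw [h3, mul_assoc, ← mul_assoc (leg13 (flip R)), ← map_mul, h2, map_one, one_mul,
      ← map_mul, h2, map_one]

lemma onLeft_comul (h : H) : onLeft Δ (Δ h) = onRight Δ (Δ h) :=
  Coalgebra.coassoc_apply (R := k) h

namespace TwistingCocycle

variable (F : TwistingCocycle k H)

local notation "Fi" => ((F.F⁻¹ : (H ⊗[k] H)ˣ) : H ⊗[k] H)
local notation "Fv" => (F.F : H ⊗[k] H)

lemma cocycle_inv : leg12 Fi * onLeft Δ Fi = leg23 Fi * onRight Δ Fi := by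
  have e (f : H ⊗[k] H →ₐ[k] H ⊗[k] (H ⊗[k] H)) : f Fi * f Fv = 1 := by
    rw [← map_mul, Units.inv_mul, map_one]
  have e' (f : H ⊗[k] H →ₐ[k] H ⊗[k] (H ⊗[k] H)) : f Fv * f Fi = 1 := by
    rw [← map_mul, Units.mul_inv, map_one]
  have e1 : leg12 Fi * onLeft Δ Fi * (onLeft Δ Fv * leg12 Fv) = 1 := by
    rw [mul_assoc, ← mul_assoc (onLeft Δ Fi), e, one_mul, e]
  have e2 : onLeft Δ Fv * leg12 Fv * (leg23 Fi * onRight Δ Fi) = 1 := by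
    rw [F.cocycle, mul_assoc, ← mul_assoc (leg23 Fv), e', one_mul, e']
  exact left_inv_eq_right_inv e1 e2

lemma theta_mul_thetaInv : F.theta * F.thetaInv = 1 := by
  have h := tripL_onLeft Fv Fv Fi
  rw [F.counit_left, F.cocycle, mul_assoc, ← map_mul, Units.mul_inv, map_one, mul_one,
    tripL_onRight, F.counit_right, HopfAlgebra.antipode_one, mul_one, actL_eq, actR_eq] at h
  exact h.symm

lemma thetaInv_mul_theta : F.thetaInv * F.theta = 1 := by
  have cl : counitLeft ε Fi = 1 := by
    have := congrArg (counitLeft ε) F.F.mul_inv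
    rwa [map_mul, F.counit_left, one_mul, map_one] at this
  have cr : counitRight ε Fi = 1 := by
    have := congrArg (counitRight ε) F.F.mul_inv
    rwa [map_mul, F.counit_right, one_mul, map_one] at this
  have h := tripR_onLeft Fi Fv Fi
  rw [cl, mul_assoc, F.cocycle_inv, ← mul_assoc, ← map_mul, Units.mul_inv, map_one, one_mul,
    tripR_onRight, cr, mul_one, actL_eq, actR_eq] at h
  exact h.symm

/-- The twisted antipode `h ↦ ϑ⁻¹ γ(h) ϑ`. -/
noncomputable def antipode : H →ₗ[k] H :=
  (LinearMap.mulLeft k F.thetaInv).comp ((LinearMap.mulRight k F.theta).comp γ)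

lemma antipode_apply (h : H) : F.antipode h = F.thetaInv * (γ h * F.theta) := rfl

lemma comul_apply (h : H) : F.comul h = Fi * Δ h * Fv := rfl

lemma antipode_left (h : H) :
    LinearMap.mul' k H (LinearMap.rTensor H F.antipode (F.comul h)) = algebraMap k H (ε h) := by
  have key : ∀ X : H ⊗[k] H, LinearMap.mul' k H (LinearMap.rTensor H F.antipode X) =
      F.thetaInv * actL k X F.theta := by
    intro X
    induction X with
    | zero => simp
    | add A A' h h' => simp [mul_add, h, h']
    | tmul p q => simp [antipode_apply, mul_assoc]
  have ht : F.theta = actL k Fv 1 := (actL_eq _).symm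
  rw [key, comul_apply, actL_mul, actL_mul]
  have e : actL k Fi F.theta = 1 := by rw [ht, ← actL_mul, Units.mul_inv, actL_one]
  rw [e, actL_comul, Algebra.algebraMap_eq_smul_one, map_smul,
    ← ht, mul_smul_comm, thetaInv_mul_theta]

lemma antipode_right (h : H) :
    LinearMap.mul' k H (LinearMap.lTensor H F.antipode (F.comul h)) = algebraMap k H (ε h) := by
  have key : ∀ X : H ⊗[k] H, LinearMap.mul' k H (LinearMap.lTensor H F.antipode X) =
      actR k X F.thetaInv * F.theta := by
    intro X
    induction X with
    | zero => simp
    | add A A' h h' => simp [add_mul, h, h']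
    | tmul p q => simp [antipode_apply, mul_assoc]
  have ht : F.thetaInv = actR k Fi 1 := (actR_eq _).symm
  rw [key, comul_apply, actR_mul, actR_mul]
  have e : actR k Fv F.thetaInv = 1 := by rw [ht, ← actR_mul, Units.mul_inv, actR_one]
  rw [e, actR_comul, Algebra.algebraMap_eq_smul_one, map_smul,
    ← ht, smul_mul_assoc, thetaInv_mul_theta]

lemma coassoc (h : H) : onLeft F.comul (F.comul h) = onRight F.comul (F.comul h) := by
  rw [comul, onLeft_conj, onRight_conj, AlgHom.comp_apply, conj_apply]
  simp only [map_mul]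
  rw [onLeft_comul]
  calc _ = (leg12 Fi * onLeft Δ Fi) * onRight Δ (Δ h) * (onLeft Δ Fv * leg12 Fv) := by
        simp only [mul_assoc]
    _ = _ := by rw [F.cocycle_inv, F.cocycle]; simp only [mul_assoc]

lemma counitLeft_comul (h : H) : counitLeft ε (F.comul h) = h := by
  have cl : counitLeft ε Fi = 1 := by
    have := congrArg (counitLeft ε) F.F.mul_inv
    rwa [map_mul, F.counit_left, one_mul, map_one] at this
  rw [comul_apply, map_mul, map_mul, cl, F.counit_left, one_mul, mul_one]
  have := congrArg (TensorProduct.lid k H) (Coalgebra.rTensor_counit_comul (R := k) h)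
  rw [TensorProduct.lid_tmul, one_smul] at this
  exact this

lemma counitRight_comul (h : H) : counitRight ε (F.comul h) = h := by
  have cl : counitRight ε Fi = 1 := by
    have := congrArg (counitRight ε) F.F.mul_inv
    rwa [map_mul, F.counit_right, one_mul, map_one] at this
  rw [comul_apply, map_mul, map_mul, cl, F.counit_right, one_mul, mul_one]
  have := congrArg (TensorProduct.rid k H) (Coalgebra.lTensor_counit_comul (R := k) h)
  rw [TensorProduct.rid_tmul, one_smul] at this
  exact this

/-- The twisted coalgebra structure together with the unchanged multiplication. -/
@[reducible] noncomputable def toBialgebra : Bialgebra k H :=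
  Bialgebra.ofAlgHom F.comul ε
    (by ext h; exact F.coassoc h)
    (by
      ext h
      apply (Algebra.TensorProduct.lid k H).injective
      simpa [counitLeft] using F.counitLeft_comul h)
    (by
      ext h
      apply (Algebra.TensorProduct.rid k k H).injective
      simpa [counitRight] using F.counitRight_comul h)

end TwistingCocycle

end TwistConstruction

section Twist

variable {k : Type u} {H : Type v} [CommRing k] [Ring H] [TriangularHopfAlgebra k H]

local notation "Δ" => Bialgebra.comulAlgHom k H
local notation "RR" => (TriangularHopfAlgebra.R : H ⊗[k] H)

namespace TwistingCocycle

variable (F : TwistingCocycle k H)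

local notation "Fi" => ((F.F⁻¹ : (H ⊗[k] H)ˣ) : H ⊗[k] H)
local notation "Fv" => (F.F : H ⊗[k] H)

/-- The twisted R-matrix `F₂₁⁻¹ R F`. -/
def rMatrix : H ⊗[k] H := flip Fi * RR * Fv

lemma flip_inv_mul : flip Fi * flip Fv = 1 := by rw [← map_mul, Units.inv_mul, map_one]
lemma flip_mul_inv : flip Fv * flip Fi = 1 := by rw [← map_mul, Units.mul_inv, map_one]

lemma rMatrix_mul_flip : F.rMatrix * flip F.rMatrix = 1 := by
  simp only [rMatrix, map_mul, flip_flip]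
  calc flip Fi * RR * Fv * (Fi * flip RR * flip Fv)
      = flip Fi * (RR * ((Fv * Fi) * flip RR)) * flip Fv := by simp only [mul_assoc]
    _ = 1 := by
      rw [Units.mul_inv, one_mul, TriangularHopfAlgebra.R_mul_flip, mul_one, flip_inv_mul]

lemma rMatrix_mul_comul (h : H) : F.rMatrix * F.comul h = flip (F.comul h) * F.rMatrix := by
  simp only [rMatrix, comul_apply, map_mul]
  calc flip Fi * RR * Fv * (Fi * Δ h * Fv)
      = flip Fi * (RR * ((Fv * Fi) * Δ h)) * Fv := by simp only [mul_assoc]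
    _ = flip Fi * flip (Δ h) * ((flip Fv * flip Fi) * (RR * Fv)) := by
      rw [Units.mul_inv, one_mul, TriangularHopfAlgebra.R_mul_comul, flip_mul_inv, one_mul]
      simp only [mul_assoc]
    _ = _ := by simp only [mul_assoc]

lemma comul_left_rMatrix : onLeft F.comul F.rMatrix = leg13 F.rMatrix * leg23 F.rMatrix := by
  have e (f : H ⊗[k] H →ₐ[k] H ⊗[k] (H ⊗[k] H)) : f Fi * f Fv = 1 := by
    rw [← map_mul, Units.inv_mul, map_one]
  have e' (f : H ⊗[k] H →ₐ[k] H ⊗[k] (H ⊗[k] H)) : f Fv * f Fi = 1 := by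
    rw [← map_mul, Units.mul_inv, map_one]
  have g (f : H ⊗[k] H →ₐ[k] H ⊗[k] (H ⊗[k] H)) : f (flip Fi) * f (flip Fv) = 1 := by
    rw [← map_mul, flip_inv_mul, map_one]
  have g' (f : H ⊗[k] H →ₐ[k] H ⊗[k] (H ⊗[k] H)) : f (flip Fv) * f (flip Fi) = 1 := by
    rw [← map_mul, flip_mul_inv, map_one]
  have c1 : swap23 (onLeft Δ Fv) * leg13 Fv = onRight (flip.comp Δ) Fv * leg23 (flip Fv) := by
    have := congrArg swap23 F.cocycle
    rwa [map_mul, map_mul, swap23_leg12, swap23_leg23, swap23_onRight] at this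
  have c2 : cyc (onLeft Δ Fv) * leg13 (flip Fv) = onLeft Δ (flip Fv) * leg12 Fv := by
    have := congrArg cyc F.cocycle
    rwa [map_mul, map_mul, cyc_leg12, cyc_leg23, cyc_onRight] at this
  have c3 : leg13 RR * swap23 (onLeft Δ Fv) = cyc (onLeft Δ Fv) * leg13 RR := by
    have := congrArg swap23
      (leg12_mul_onLeft Δ RR TriangularHopfAlgebra.R_mul_comul Fv)
    rwa [map_mul, map_mul, swap23_leg12, swap23_onLeft_flip] at this
  have c4 := leg23_mul_onRight Δ RR TriangularHopfAlgebra.R_mul_comul Fv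
  have c1' : onRight (flip.comp Δ) Fv = swap23 (onLeft Δ Fv) * leg13 Fv * leg23 (flip Fi) := by
    rw [c1, mul_assoc, g', mul_one]
  have c2' : cyc (onLeft Δ Fv) = onLeft Δ (flip Fv) * leg12 Fv * leg13 (flip Fi) := by
    rw [← c2, mul_assoc, g', mul_one]
  rw [comul, onLeft_conj]
  simp only [rMatrix, map_mul]
  rw [TriangularHopfAlgebra.comul_left_R]
  calc leg12 Fi * (onLeft Δ (flip Fi) * (leg13 RR * leg23 RR) * onLeft Δ Fv) * leg12 Fv
      = leg12 Fi * onLeft Δ (flip Fi) * leg13 RR * leg23 RR * (onLeft Δ Fv * leg12 Fv) := by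
        simp only [mul_assoc]
    _ = leg12 Fi * onLeft Δ (flip Fi) * leg13 RR * (leg23 RR * onRight Δ Fv) * leg23 Fv := by
        rw [F.cocycle]; simp only [mul_assoc]
    _ = leg12 Fi * onLeft Δ (flip Fi) * (leg13 RR * swap23 (onLeft Δ Fv)) * leg13 Fv *
          leg23 (flip Fi) * leg23 RR * leg23 Fv := by
        rw [c4, c1']; simp only [mul_assoc]
    _ = leg12 Fi * ((onLeft Δ (flip Fi) * onLeft Δ (flip Fv)) * leg12 Fv) * leg13 (flip Fi) *
          leg13 RR * leg13 Fv * leg23 (flip Fi) * leg23 RR * leg23 Fv := by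
        rw [c3, c2']; simp only [mul_assoc]
    _ = _ := by rw [g, one_mul, e, one_mul]; simp only [mul_assoc]

end TwistingCocycle

/-- The twist of a triangular Hopf algebra `H` by a cocycle `F`: the same algebra with the same
counit, with comultiplication `h ↦ F⁻¹ Δ(h) F`, antipode `h ↦ ϑ⁻¹ γ(h) ϑ` and R-matrix
`F₂₁⁻¹ R F`. Here it is a structure on `H` itself. -/
@[reducible] noncomputable def TwistingCocycle.twistedStructure (F : TwistingCocycle k H) :
    TriangularHopfAlgebra k H where
  toBialgebra := F.toBialgebra
  antipode := F.antipode
  mul_antipode_rTensor_comul := by ext h; exact F.antipode_left h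
  mul_antipode_lTensor_comul := by ext h; exact F.antipode_right h
  R := F.rMatrix
  R_mul_flip := F.rMatrix_mul_flip
  comul_left_R := F.comul_left_rMatrix
  comul_right_R := hexagon_right F.comul F.rMatrix F.rMatrix_mul_flip F.comul_left_rMatrix
  R_mul_comul := F.rMatrix_mul_comul

/-- A copy of the algebra `H`, which carries the twisted structure `H̃`. -/
def Twist (_ : TwistingCocycle k H) : Type v := H

noncomputable instance (F : TwistingCocycle k H) : Ring (Twist F) := inferInstanceAs (Ring H)

noncomputable instance (F : TwistingCocycle k H) : TriangularHopfAlgebra k (Twist F) :=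
  F.twistedStructure

end Twist

end HopfTwist

/-! Twisting is governed by the linear map `D(a) = ad(F₁)(a) F₂`, written `adMul a F` below. The
cocycle identity gives the second form `D(a) = F⁻¹₁ a γ(F⁻¹₂) ϑ` (`adMul_eq`), from which an inverse
can be read off. Three properties of `D` carry the proof.

It intertwines `ad` with the adjoint action of the twist (`ad_twistedStructure`). It sends `Lie(H)`
into `Lie(H̃)` (`adMul_mem_LieSet`); this rests on the `ad`-stability of `Lie(H)` (`ad_mem_LieSet`),
on the cocycle identity and on `R Δ = Δᵒᵖ R`. It is multiplicative up to a twist: `D(a) D(b) =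
D(ad(F₁)(a) ad(F₂)(b))` (`adMul_mul_adMul`).

Let `B` be the subalgebra generated by `Lie(H̃)`. As `D` is onto, it is enough that `D(b) ∈ B` for
all `b`, and `b` is a polynomial in elements of `Lie(H)`. Because of the twist in the product rule,
the property that passes to products is the stronger one that `D(ad(h)(b)) ∈ B` for every `h`. It
holds on `Lie(H)` by `ad`-stability. For products, `D(ad(h)(ab))` is the sum of the terms
`D(ad(X₁)(a)) D(ad(X₂)(b))` with `X = F⁻¹ Δ(h)` (`adMul_ad_mul_mem`). -/

namespace HopfTwist

/-! ### Identities for the adjoint action of a Hopf algebra -/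

section AdjointIdentities

variable {k : Type*} {H : Type*} [CommRing k] [Ring H] [HopfAlgebra k H]

local notation "Δ" => Bialgebra.comulAlgHom k H
local notation "ε" => Bialgebra.counitAlgHom k H
local notation "γ" => HopfAlgebra.antipode k (A := H)
local notation "assoc₃" => Algebra.TensorProduct.assoc k k k H H H

lemma ad_apply (h a : H) : ad k h a = actR k (Δ h) a := rfl

lemma ad_mul (g h a : H) : ad k (g * h) a = ad k g (ad k h a) := by
  simp only [ad_apply, map_mul, actR_mul]

lemma ad_one_left (a : H) : ad k 1 a = a := by
  rw [ad_apply, map_one, actR_one]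

lemma ad_one_right (h : H) : ad k h 1 = algebraMap k H (ε h) := by
  rw [ad_apply, actR_comul]

/-- The map `x ⊗ y ↦ ad(x)(ξ) y`. -/
noncomputable def adMul (ξ : H) : H ⊗[k] H →ₗ[k] H :=
  LinearMap.mul' k H ∘ₗ LinearMap.rTensor H ((ad k).flip ξ)

@[simp] lemma adMul_tmul (ξ x y : H) : adMul ξ (x ⊗ₜ[k] y) = ad k x ξ * y := by simp [adMul]

/-- The map `x ⊗ y ⊗ z ↦ x ξ γ(y) z`. -/
noncomputable def insertMul (ξ : H) : H ⊗[k] (H ⊗[k] H) →ₗ[k] H :=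
  LinearMap.mul' k H ∘ₗ TensorProduct.map (LinearMap.mulRight k ξ)
    (LinearMap.mul' k H ∘ₗ LinearMap.rTensor H γ)

@[simp] lemma insertMul_tmul (ξ x y z : H) :
    insertMul ξ (x ⊗ₜ[k] (y ⊗ₜ[k] z)) = x * ξ * (γ y * z) := by
  simp [insertMul]

lemma insertMul_onLeft (ξ : H) (T : H ⊗[k] H) : insertMul ξ (onLeft Δ T) = adMul ξ T := by
  induction T with
  | zero => simp
  | add A A' h h' => simp only [map_add, h, h']
  | tmul x y =>
    rw [onLeft_tmul, adMul_tmul, ad_apply]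
    induction Δ x with
    | zero => simp
    | add A A' h h' =>
      simp only [map_add, LinearMap.add_apply, TensorProduct.add_tmul, add_mul, h, h']
    | tmul p q => simp [mul_assoc]

/-- The coproduct in the last two legs of `T` meets as `γ(y⁽¹⁾) y⁽²⁾ = ε(y)`, because `γ` reverses
products. The free factors `A` and `C` leave room for the cocycle identity. -/
lemma insertMul_onRight (ξ : H) (T A C : H ⊗[k] H) :
    insertMul ξ (onRight Δ T * leg23 A * leg12 C) =
      counitRight ε T * actR k C ξ * actL k A 1 := by
  induction A with
  | zero => simp
  | add A A' h h' => simp only [map_add, add_mul, mul_add, LinearMap.add_apply, h, h']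
  | tmul a b =>
  induction C with
  | zero => simp
  | add A A' h h' => simp only [map_add, add_mul, mul_add, LinearMap.add_apply, h, h']
  | tmul c d =>
  induction T with
  | zero => simp
  | add A A' h h' => simp only [map_add, add_mul, h, h']
  | tmul x y =>
    have key : ∀ D : H ⊗[k] H,
        insertMul ξ ((x ⊗ₜ[k] D) * leg23 (a ⊗ₜ[k] b) * leg12 (c ⊗ₜ[k] d)) =
          x * c * ξ * (γ d * γ a) * actL k D 1 * b := by
      intro D
      induction D with
      | zero => simp
      | add A A' h h' =>
        simp only [map_add, add_mul, mul_add, LinearMap.add_apply, TensorProduct.tmul_add, h, h']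
      | tmul p q => simp [HopfAlgebra.antipode_mul_antidistrib, mul_assoc]
    rw [onRight_tmul, key, actL_comul]
    simp [Algebra.algebraMap_eq_smul_one, mul_assoc]

lemma counitRight_comul (h : H) : counitRight ε (Δ h) = h := by
  have := congrArg (TensorProduct.rid k H) (Coalgebra.lTensor_counit_comul (R := k) h)
  rw [TensorProduct.rid_tmul, one_smul] at this
  exact this

/-- `ad(h⁽¹⁾)(ξ) h⁽²⁾ = h ξ`. -/
lemma adMul_comul (ξ h : H) : adMul ξ (Δ h) = h * ξ := by
  -- Both bracketings of `h⁽¹⁾ ξ γ(h⁽²⁾) h⁽³⁾`: the left one forms `ad(h⁽¹⁾)(ξ) h⁽²⁾`, the right one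
  -- cancels the antipode.
  have := insertMul_onRight ξ (Δ h) 1 1
  rw [map_one, map_one, mul_one, mul_one, ← onLeft_comul, insertMul_onLeft, actR_one, actL_one,
    counitRight_comul, mul_one] at this
  exact this

lemma adMul_mul (ξ : H) (X : H ⊗[k] H) (a b : H) :
    adMul ξ (X * (a ⊗ₜ[k] b)) = adMul (ad k a ξ) X * b := by
  induction X with
  | zero => simp
  | add A A' h h' => simp only [map_add, add_mul, h, h']
  | tmul p q => simp [ad_mul, mul_assoc]

/-- `h (ad(x)(ξ) y) = ad(h⁽¹⁾ x)(ξ) h⁽²⁾ y`. -/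
lemma adMul_comul_mul (ξ h : H) (X : H ⊗[k] H) : adMul ξ (Δ h * X) = h * adMul ξ X := by
  induction X with
  | zero => simp
  | add A A' h h' => simp only [map_add, mul_add, h, h']
  | tmul p q => rw [adMul_mul, adMul_comul, adMul_tmul, mul_assoc]

/-- The map `x ⊗ y ↦ ad(x)(a) ad(y)(b)`. -/
noncomputable def adMulAd (a b : H) : H ⊗[k] H →ₗ[k] H :=
  LinearMap.mul' k H ∘ₗ TensorProduct.map ((ad k).flip a) ((ad k).flip b)

@[simp] lemma adMulAd_tmul (a b x y : H) :
    adMulAd a b (x ⊗ₜ[k] y) = ad k x a * ad k y b := by simp [adMulAd]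

/-- `ad(h)(a b) = ad(h⁽¹⁾)(a) ad(h⁽²⁾)(b)`. -/
lemma ad_mul_right (h a b : H) : ad k h (a * b) = adMulAd a b (Δ h) := by
  -- `ψ` is `x ⊗ y ⊗ z ↦ ad(x)(a) y b γ(z)`. On the iterated coproduct of `h`, the right bracketing
  -- gives `ad(h⁽¹⁾)(a) ad(h⁽²⁾)(b)`; in the left one `ad(h⁽¹⁾)(a) h⁽²⁾` collapses to `h a` by
  -- `adMul_comul`.
  let ψ : H ⊗[k] (H ⊗[k] H) →ₗ[k] H :=
    LinearMap.mul' k H ∘ₗ TensorProduct.map ((ad k).flip a) ((actR k).flip b)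
  have hψ (x : H) (Y : H ⊗[k] H) : ψ (x ⊗ₜ[k] Y) = ad k x a * actR k Y b := by simp [ψ]
  have h1 (X : H ⊗[k] H) : ψ (onRight Δ X) = adMulAd a b X := by
    induction X with
    | zero => simp
    | add A A' h h' => simp only [map_add, h, h']
    | tmul p q => rw [onRight_tmul, hψ, adMulAd_tmul, ad_apply q]
  have h2 (X : H ⊗[k] H) : ψ (onLeft Δ X) = actR k X (a * b) := by
    induction X with
    | zero => simp
    | add A A' h h' => simp only [map_add, LinearMap.add_apply, h, h']
    | tmul p q =>
      have key (Y : H ⊗[k] H) : ψ (assoc₃ (Y ⊗ₜ[k] q)) = adMul a Y * (b * γ q) := by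
        induction Y with
        | zero => simp
        | add A A' h h' => simp only [map_add, TensorProduct.add_tmul, add_mul, h, h']
        | tmul x y => simp [hψ, mul_assoc]
      rw [onLeft_tmul, key, adMul_comul, actR_tmul]
      simp only [mul_assoc]
  rw [ad_apply, ← h2, onLeft_comul, h1]

/-- Linear maps that agree after convolution with an algebra map are equal. -/
lemma eq_of_convolution_eq {A : Type*} [Ring A] [Algebra k A] (f f' : H →ₗ[k] A) (g : H →ₐ[k] A)
    (hf : ∀ h, LinearMap.mul' k A (TensorProduct.map f g.toLinearMap (Δ h)) =
      LinearMap.mul' k A (TensorProduct.map f' g.toLinearMap (Δ h))) (h : H) : f h = f' h := by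
  -- An algebra map `g` has convolution inverse `g ∘ γ`, so `f = (f * g) * (g ∘ γ)` is recovered
  -- from `f * g`.
  have main (f : H →ₗ[k] A) : f h = LinearMap.mul' k A (TensorProduct.map
      (LinearMap.mul' k A ∘ₗ TensorProduct.map f g.toLinearMap ∘ₗ (Δ).toLinearMap)
      (g.toLinearMap ∘ₗ γ) (Δ h)) := by
    let ψ : H ⊗[k] (H ⊗[k] H) →ₗ[k] A := LinearMap.mul' k A ∘ₗ
      TensorProduct.map f (g.toLinearMap ∘ₗ LinearMap.mul' k H ∘ₗ LinearMap.lTensor H γ)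
    have h1 (X : H ⊗[k] H) : ψ (onRight Δ X) = f (counitRight ε X) := by
      induction X with
      | zero => simp
      | add A A' h h' => simp only [map_add, h, h']
      | tmul p q =>
        have e : LinearMap.mul' k H (LinearMap.lTensor H γ (Δ q)) = algebraMap k H (ε q) :=
          HopfAlgebra.mul_antipode_lTensor_comul_apply q
        simp only [ψ, onRight_tmul, LinearMap.comp_apply, TensorProduct.map_tmul, e]
        simp [Algebra.algebraMap_eq_smul_one]
    have h2 (X : H ⊗[k] H) : ψ (onLeft Δ X) = LinearMap.mul' k A (TensorProduct.map
        (LinearMap.mul' k A ∘ₗ TensorProduct.map f g.toLinearMap ∘ₗ (Δ).toLinearMap)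
        (g.toLinearMap ∘ₗ γ) X) := by
      induction X with
      | zero => simp
      | add A A' h h' => simp only [map_add, h, h']
      | tmul p q =>
        rw [onLeft_tmul]
        simp only [TensorProduct.map_tmul, LinearMap.comp_apply, LinearMap.mul'_apply,
          AlgHom.toLinearMap_apply]
        induction Δ p with
        | zero => simp
        | add A A' h h' => simp only [map_add, TensorProduct.add_tmul, add_mul, h, h']
        | tmul x y => simp [ψ, mul_assoc]
    rw [← h2, onLeft_comul, h1, counitRight_comul]
  have e : LinearMap.mul' k A ∘ₗ TensorProduct.map f g.toLinearMap ∘ₗ (Δ).toLinearMap =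
      LinearMap.mul' k A ∘ₗ TensorProduct.map f' g.toLinearMap ∘ₗ (Δ).toLinearMap :=
    LinearMap.ext hf
  rw [main f, main f', e]

/-- The map `x ⊗ y ⊗ z ↦ ad(x)(ξ) y ⊗ z`. -/
noncomputable def adMulLeft (ξ : H) : H ⊗[k] (H ⊗[k] H) →ₗ[k] H ⊗[k] H :=
  LinearMap.rTensor H (adMul ξ) ∘ₗ (assoc₃).symm.toLinearMap

/-- The map `x ⊗ y ⊗ z ↦ x ⊗ ad(y)(ξ) z`. -/
noncomputable def adMulRight (ξ : H) : H ⊗[k] (H ⊗[k] H) →ₗ[k] H ⊗[k] H :=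
  LinearMap.lTensor H (adMul ξ)

@[simp] lemma adMulLeft_tmul (ξ x y z : H) :
    adMulLeft ξ (x ⊗ₜ[k] (y ⊗ₜ[k] z)) = (ad k x ξ * y) ⊗ₜ[k] z := by simp [adMulLeft]

@[simp] lemma adMulRight_tmul (ξ x : H) (Y : H ⊗[k] H) :
    adMulRight ξ (x ⊗ₜ[k] Y) = x ⊗ₜ[k] adMul ξ Y := by simp [adMulRight]

/-- The permutation `a ⊗ b ⊗ c ↦ b ⊗ a ⊗ c`. -/
noncomputable def swap12 : H ⊗[k] (H ⊗[k] H) →ₐ[k] H ⊗[k] (H ⊗[k] H) :=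
  cyc.comp (swap23.comp (cyc.comp cyc))

@[simp] lemma swap12_tmul (a b c : H) :
    swap12 (a ⊗ₜ[k] (b ⊗ₜ[k] c)) = b ⊗ₜ[k] (a ⊗ₜ[k] c) := by simp [swap12]

lemma swap12_leg12 (X : H ⊗[k] H) : swap12 (leg12 X) = leg12 (flip X) := by
  induction X with
  | zero => simp
  | add A A' h h' => simp only [map_add, h, h']
  | tmul p q => simp

lemma swap12_onLeft_flip (D : H →ₐ[k] H ⊗[k] H) (X : H ⊗[k] H) :
    swap12 (onLeft (flip.comp D) X) = onLeft D X := by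
  induction X with
  | zero => simp
  | add A A' h h' => simp only [map_add, h, h']
  | tmul p q =>
    rw [onLeft_tmul, onLeft_tmul, AlgHom.comp_apply]
    induction D p with
    | zero => simp
    | add A A' h h' => simp only [map_add, TensorProduct.add_tmul, h, h']
    | tmul p q => simp

/-- This is `R₂ h⁽²⁾ ⊗ R₁ h⁽¹⁾ = h⁽¹⁾ R₂ ⊗ h⁽²⁾ R₁` on the first two legs: it moves the R-matrix
past a coproduct and restores the order of the legs. -/
lemma swap12_leg12_mul_onLeft (R : H ⊗[k] H) (hR : ∀ h, R * Δ h = flip (Δ h) * R)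
    (X : H ⊗[k] H) : swap12 (leg12 R * onLeft Δ X) = onLeft Δ X * leg12 (flip R) := by
  rw [leg12_mul_onLeft Δ R hR, map_mul, swap12_onLeft_flip, swap12_leg12]

/-- By `adMul_comul_mul` in the first leg, a factor contracted through its coproduct comes out as
plain left multiplication. -/
lemma adMulLeft_onLeft (ξ : H) (X Y : H ⊗[k] H) :
    adMulLeft ξ (onLeft Δ X * leg12 Y) = X * (adMul ξ Y ⊗ₜ[k] (1 : H)) := by
  induction Y with
  | zero => simp
  | add A A' h h' => simp only [map_add, mul_add, TensorProduct.add_tmul, h, h']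
  | tmul a b =>
  induction X with
  | zero => simp
  | add A A' h h' => simp only [map_add, add_mul, h, h']
  | tmul x y =>
    have key (Z : H ⊗[k] H) : adMulLeft ξ (assoc₃ (Z ⊗ₜ[k] y) * leg12 (a ⊗ₜ[k] b)) =
        adMul ξ (Z * (a ⊗ₜ[k] b)) ⊗ₜ[k] y := by
      induction Z with
      | zero => simp
      | add A A' h h' => simp only [map_add, add_mul, TensorProduct.add_tmul, h, h']
      | tmul p q => simp
    rw [onLeft_tmul, key, adMul_comul_mul]
    simp

lemma adMulRight_onRight (ξ : H) (X : H ⊗[k] H) (Z : H ⊗[k] (H ⊗[k] H)) :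
    adMulRight ξ (onRight Δ X * Z) = X * adMulRight ξ Z := by
  induction Z with
  | zero => simp
  | add A A' h h' => simp only [map_add, mul_add, h, h']
  | tmul z Y =>
  induction X with
  | zero => simp
  | add A A' h h' => simp only [map_add, add_mul, h, h']
  | tmul x y => simp [-Bialgebra.comulAlgHom_apply, adMul_comul_mul]

lemma adMulRight_leg12 (ξ : H) (R : H ⊗[k] H) :
    adMulRight ξ (leg12 (flip R)) = flip (LinearMap.rTensor H ((ad k).flip ξ) R) := by
  induction R with
  | zero => simp
  | add A A' h h' => simp only [map_add, h, h']
  | tmul x y => simp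

lemma adMulLeft_leg23 (ξ x : H) (Y : H ⊗[k] H) :
    adMulLeft ξ (x ⊗ₜ[k] Y) = (ad k x ξ ⊗ₜ[k] (1 : H)) * Y := by
  induction Y with
  | zero => simp
  | add A A' h h' => simp only [map_add, mul_add, TensorProduct.tmul_add, h, h']
  | tmul x y => simp

/-- Since `ad(R₁ x) = ad(R₁) ad(x)`, the result is the second term of the Lie condition for
`ad(x)(ξ)`, times `Y`. -/
lemma adMulRight_swap12 (ξ x : H) (R Y : H ⊗[k] H) :
    adMulRight ξ (swap12 (leg12 R * (x ⊗ₜ[k] Y))) =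
      flip (LinearMap.rTensor H ((ad k).flip (ad k x ξ)) R) * Y := by
  induction Y with
  | zero => simp
  | add A A' h h' => simp only [map_add, mul_add, TensorProduct.tmul_add, h, h']
  | tmul p q =>
    induction R with
    | zero => simp
    | add A A' h h' => simp only [map_add, add_mul, h, h']
    | tmul a b => simp [ad_mul]

end AdjointIdentities

/-! ### Stability of `Lie(H)` under the adjoint action -/

section LieSet

variable {k : Type*} {H : Type*} [CommRing k] [Ring H] [TriangularHopfAlgebra k H]

local notation "Δ" => Bialgebra.comulAlgHom k H
local notation "RR" => (TriangularHopfAlgebra.R : H ⊗[k] H)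

lemma mem_LieSet_iff (ξ : H) : ξ ∈ LieSet k H ↔
    Δ ξ = ξ ⊗ₜ[k] (1 : H) + flip (LinearMap.rTensor H ((ad k).flip ξ) RR) := Iff.rfl

/-- `Lie(H)` is stable under the adjoint action. -/
lemma ad_mem_LieSet {ξ : H} (hξ : ξ ∈ LieSet k H) (h : H) : ad k h ξ ∈ LieSet k H := by
  rw [mem_LieSet_iff] at hξ ⊢
  -- `f` and `f'` are the two sides of the Lie condition for `ad(h)(ξ)`, as linear maps in `h`. They
  -- are compared after convolution with `Δ`.
  let f : H →ₗ[k] H ⊗[k] H := (Δ).toLinearMap ∘ₗ (ad k).flip ξ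
  let f' : H →ₗ[k] H ⊗[k] H :=
    (TensorProduct.mk k H H).flip 1 ∘ₗ (ad k).flip ξ +
      adMulRight ξ ∘ₗ (swap12 (k := k) (H := H)).toLinearMap ∘ₗ LinearMap.mulLeft k (leg12 RR) ∘ₗ
        (TensorProduct.mk k H (H ⊗[k] H)).flip 1
  have f'_apply (x : H) : f' x = ad k x ξ ⊗ₜ[k] (1 : H) +
      flip (LinearMap.rTensor H ((ad k).flip (ad k x ξ)) RR) := by
    have := adMulRight_swap12 ξ x RR 1
    rw [mul_one] at this
    rw [← this]
    rfl
  have hf (X : H ⊗[k] H) :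
      LinearMap.mul' k _ (TensorProduct.map f (Δ).toLinearMap X) = Δ (adMul ξ X) := by
    induction X with
    | zero => simp
    | add A A' h h' => simp only [map_add, h, h']
    | tmul x y => simp [f]
  have hf' (X : H ⊗[k] H) :
      LinearMap.mul' k _ (TensorProduct.map f' (Δ).toLinearMap X) =
        adMulLeft ξ (onRight Δ X) + adMulRight ξ (swap12 (leg12 RR * onRight Δ X)) := by
    induction X with
    | zero => simp
    | add A A' h h' => simp only [map_add, mul_add, h, h']; abel
    | tmul x y =>
      rw [TensorProduct.map_tmul, LinearMap.mul'_apply, f'_apply, onRight_tmul, adMulLeft_leg23,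
        adMulRight_swap12, add_mul, AlgHom.toLinearMap_apply]
  -- Both sides are `Δ(g) Δ(ξ)`: the left is `Δ(g ξ)`; on the right, `R Δ = Δᵒᵖ R` lets `Δ(g)` be
  -- pulled out in front of the two terms of `Δ(ξ)`.
  have conv (g : H) : LinearMap.mul' k _ (TensorProduct.map f (Δ).toLinearMap (Δ g)) =
      LinearMap.mul' k _ (TensorProduct.map f' (Δ).toLinearMap (Δ g)) := by
    have hL := adMulLeft_onLeft ξ (Δ g) 1
    rw [map_one, mul_one, Algebra.TensorProduct.one_def, adMul_tmul, ad_one_left, mul_one] at hL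
    rw [hf, hf', adMul_comul, map_mul, hξ, ← onLeft_comul, hL,
      swap12_leg12_mul_onLeft _ TriangularHopfAlgebra.R_mul_comul, onLeft_comul,
      adMulRight_onRight, adMulRight_leg12, mul_add]
  rw [← f'_apply]
  exact eq_of_convolution_eq f f' Δ conv h

/-- Each `ad(x)(ξ)` lies in `Lie(H)`, so its coproduct is known. The factor `G` is kept so that for
`X = G = F` one side of the cocycle identity appears. -/
lemma comul_adMul {ξ : H} (hξ : ξ ∈ LieSet k H) (X : H ⊗[k] H) (G : H ⊗[k] H) :
    Δ (adMul ξ X) * G = adMulLeft ξ (onRight Δ X * leg23 G) +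
      adMulRight ξ (swap12 (leg12 RR * (onRight Δ X * leg23 G))) := by
  induction X with
  | zero => simp
  | add A A' h h' => simp only [map_add, mul_add, add_mul, h, h']; abel
  | tmul x y =>
    have e : onRight Δ (x ⊗ₜ[k] y) * leg23 G = x ⊗ₜ[k] (Δ y * G) := by simp [leg23]
    rw [e, adMulLeft_leg23, adMulRight_swap12, adMul_tmul, map_mul,
      (mem_LieSet_iff _).1 (ad_mem_LieSet hξ x), mul_assoc, add_mul]

end LieSet

namespace TwistingCocycle

/-! ### The map `D(a) = ad(F₁)(a) F₂` and its product rule -/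

section Hopf

variable {k : Type*} {H : Type*} [CommRing k] [Ring H] [HopfAlgebra k H]
  (F : TwistingCocycle k H)

local notation "Δ" => Bialgebra.comulAlgHom k H
local notation "Fi" => ((F.F⁻¹ : (H ⊗[k] H)ˣ) : H ⊗[k] H)
local notation "Fv" => (F.F : H ⊗[k] H)

/-- `ad(F₁)(ξ) F₂ = F⁻¹₁ ξ γ(F⁻¹₂) ϑ`. -/
lemma adMul_eq (ξ : H) : adMul ξ Fv = actR k Fi ξ * F.theta := by
  -- Apply `x ⊗ y ⊗ z ↦ x ξ γ(y) z` to `(Δ ⊗ id)(F) = (id ⊗ Δ)(F) F₂₃ F₁₂⁻¹`. The left side gives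
  -- `D(ξ)`; on the right `(id ⊗ Δ)(F)` contracts to `1`.
  have h := insertMul_onRight ξ Fv Fv Fi
  rw [← F.cocycle, mul_assoc, ← map_mul, Units.mul_inv, map_one, mul_one, insertMul_onLeft,
    F.counit_right, one_mul, actL_eq] at h
  exact h

lemma adMul_surjective (a : H) : ∃ b : H, adMul b Fv = a := by
  -- The witness `F₁ a ϑ⁻¹ γ(F₂)` comes from solving `F⁻¹₁ b γ(F⁻¹₂) ϑ = a` for `b`.
  refine ⟨actR k Fv (a * F.thetaInv), ?_⟩
  rw [adMul_eq, ← actR_mul, Units.inv_mul, actR_one, mul_assoc, thetaInv_mul_theta, mul_one]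

lemma adMul_one : adMul 1 Fv = 1 := by
  have h : actR k Fi 1 = F.thetaInv := actR_eq _
  rw [adMul_eq, h, thetaInv_mul_theta]

/-- The map `x ⊗ y ↦ D(ad(x)(a)) D(ad(y)(b))`, where `D(a) = ad(F₁)(a) F₂`. -/
noncomputable def twistMulAd (a b : H) : H ⊗[k] H →ₗ[k] H :=
  LinearMap.mul' k H ∘ₗ TensorProduct.map
    (adMul a ∘ₗ LinearMap.mulLeft k Fv ∘ₗ (TensorProduct.mk k H H).flip 1)
    (adMul b ∘ₗ LinearMap.mulLeft k Fv ∘ₗ (TensorProduct.mk k H H).flip 1)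

lemma twistMulAd_tmul (a b x y : H) : F.twistMulAd a b (x ⊗ₜ[k] y) =
    adMul (ad k x a) Fv * adMul (ad k y b) Fv := by
  simp [twistMulAd, adMul_mul]

/-- Both sides are values of `x ⊗ y ⊗ z ↦ ad(x)(a) ad(y)(b) z` on the two sides of the cocycle
identity. The right one uses that multiplication by `F₂` passes into `ad(y)(b) z` through `Δ(F₂)`,
the left one that `ad` acts on products through `Δ`. -/
lemma adMul_mul_adMul (a b : H) : adMul a Fv * adMul b Fv = adMul (adMulAd a b Fv) Fv := by
  let ψ : H ⊗[k] (H ⊗[k] H) →ₗ[k] H :=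
    LinearMap.mul' k H ∘ₗ TensorProduct.map ((ad k).flip a) (adMul b)
  have h1 (X Y : H ⊗[k] H) : ψ (onRight Δ X * leg23 Y) = adMul a X * adMul b Y := by
    induction X with
    | zero => simp
    | add A A' h h' => simp only [map_add, add_mul, h, h']
    | tmul p q => simp [-Bialgebra.comulAlgHom_apply, ψ, leg23, adMul_comul_mul, mul_assoc]
  have h2 (X Y : H ⊗[k] H) : ψ (onLeft Δ X * leg12 Y) = adMul (adMulAd a b Y) X := by
    induction Y with
    | zero => simp [adMul]
    | add A A' h h' =>
      simp only [map_add, mul_add, h, h']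
      simp only [adMul, map_add, LinearMap.rTensor_add, LinearMap.comp_add, LinearMap.comp_apply,
        LinearMap.add_apply]
    | tmul c d =>
    induction X with
    | zero => simp
    | add A A' h h' => simp only [map_add, add_mul, h, h']
    | tmul x y =>
      have key (Z : H ⊗[k] H) : ψ (Algebra.TensorProduct.assoc k k k H H H (Z ⊗ₜ[k] y) *
          leg12 (c ⊗ₜ[k] d)) = adMulAd (ad k c a) (ad k d b) Z * y := by
        induction Z with
        | zero => simp
        | add A A' h h' => simp only [map_add, add_mul, TensorProduct.add_tmul, h, h']
        | tmul p q => simp [ψ, ad_mul, mul_assoc]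
      rw [onLeft_tmul, key, adMul_tmul, adMulAd_tmul, ad_mul_right]
  rw [← h1, ← F.cocycle, h2]

/-- The product rule with `X` acting on the factors first. The `F` it introduces stands to the left
of `X`, so a suitable `X` removes it. -/
lemma twistMulAd_eq (a b : H) (X : H ⊗[k] H) :
    F.twistMulAd a b X = adMul (adMulAd a b (Fv * X)) Fv := by
  have hadd (a b : H) : adMul (k := k) (a + b) Fv = adMul a Fv + adMul b Fv := by
    simp only [adMul, map_add, LinearMap.rTensor_add, LinearMap.comp_apply, LinearMap.add_apply]
  have key (x y : H) (Y : H ⊗[k] H) :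
      adMulAd a b (Y * (x ⊗ₜ[k] y)) = adMulAd (ad k x a) (ad k y b) Y := by
    induction Y with
    | zero => simp
    | add A A' h h' => simp only [map_add, add_mul, h, h']
    | tmul p q => simp [ad_mul]
  induction X with
  | zero => simp [adMul]
  | add A A' h h' => simp only [map_add, mul_add, hadd, h, h']
  | tmul x y => rw [twistMulAd_tmul, adMul_mul_adMul, key]

/-- If `D(ad(h)(a)) = ad(F₁h)(a) F₂` and `D(ad(h)(b))` lie in a subalgebra for all `h`, then so do
all `D(ad(h)(ab))`. -/
lemma adMul_ad_mul_mem (B : Subalgebra k H) {a b : H} (ha : ∀ h, adMul (ad k h a) Fv ∈ B)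
    (hb : ∀ h, adMul (ad k h b) Fv ∈ B) (h : H) : adMul (ad k h (a * b)) Fv ∈ B := by
  have key (X : H ⊗[k] H) : F.twistMulAd a b X ∈ B := by
    induction X with
    | zero => simp
    | add A A' h h' => rw [map_add]; exact B.add_mem h h'
    | tmul x y => rw [twistMulAd_tmul]; exact B.mul_mem (ha x) (hb y)
  -- With `X = F⁻¹ Δ(h)` the twist in the product rule cancels, which leaves `D(ad(h⁽¹⁾)(a)
  -- ad(h⁽²⁾)(b)) = D(ad(h)(ab))`.
  have := key (Fi * Δ h)
  rwa [twistMulAd_eq, ← mul_assoc, Units.mul_inv, one_mul, ← ad_mul_right] at this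

end Hopf

/-! ### Transport of the adjoint action and of `Lie(H)` to the twist -/

section Triangular

variable {k : Type*} {H : Type*} [CommRing k] [Ring H] [TriangularHopfAlgebra k H]
  (F : TwistingCocycle k H)

local notation "Δ" => Bialgebra.comulAlgHom k H
local notation "RR" => (TriangularHopfAlgebra.R : H ⊗[k] H)
local notation "Fi" => ((F.F⁻¹ : (H ⊗[k] H)ˣ) : H ⊗[k] H)
local notation "Fv" => (F.F : H ⊗[k] H)

lemma actR_twistedStructure (X : H ⊗[k] H) (c : H) :
    @actR k H _ _ F.twistedStructure.toHopfAlgebra X c =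
      actR k X (c * F.thetaInv) * F.theta := by
  induction X with
  | zero => simp only [map_zero, LinearMap.zero_apply, zero_mul]
  | add A A' h h' => simp only [map_add, LinearMap.add_apply, add_mul, h, h']
  | tmul x y =>
    refine (@actR_tmul k H _ _ F.twistedStructure.toHopfAlgebra x y c).trans ?_
    rw [actR_tmul]
    change x * (c * F.antipode y) = _
    simp only [antipode_apply, mul_assoc]

/-- The map `ξ ↦ ad(F₁)(ξ) F₂` intertwines the adjoint actions of `H` and of its twist. -/
lemma ad_twistedStructure (h ξ : H) :
    @ad k H _ _ F.twistedStructure.toHopfAlgebra h (adMul ξ Fv) = adMul (ad k h ξ) Fv := by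
  -- In the form `D(ξ) = F⁻¹₁ ξ γ(F⁻¹₂) ϑ` the inner `ϑ ϑ⁻¹` cancels, and `F⁻¹ Δ(h) F` acting after
  -- `F⁻¹` is `F⁻¹ Δ(h)`.
  refine (F.actR_twistedStructure (F.comul h) _).trans ?_
  rw [adMul_eq, adMul_eq, mul_assoc _ F.theta, theta_mul_thetaInv, mul_one, comul_apply,
    ← actR_mul, mul_assoc _ Fv, Units.mul_inv, mul_one, actR_mul, ad_apply]

lemma mem_LieSet_twistedStructure_iff (ξ : H) : ξ ∈ @LieSet k H _ _ F.twistedStructure ↔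
    F.comul ξ = ξ ⊗ₜ[k] (1 : H) + flip (LinearMap.rTensor H
      (((@ad k H _ _ F.twistedStructure.toHopfAlgebra).flip ξ : H →ₗ[k] H)) F.rMatrix) := Iff.rfl

lemma adMulRight_leg23_mul_leg12 (ξ : H) (X Y : H ⊗[k] H) :
    adMulRight ξ (leg23 X * leg12 (flip Y)) = flip (LinearMap.rTensor H
      (adMul ξ ∘ₗ LinearMap.mulLeft k X ∘ₗ (TensorProduct.mk k H H).flip 1) Y) := by
  induction Y with
  | zero => simp
  | add A A' h h' => simp only [map_add, mul_add, h, h']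
  | tmul x y => simp [leg23]

/-- Expand `F⁻¹ Δ(D(ξ)) F` by `comul_adMul` and replace `(id ⊗ Δ)(F) F₂₃` by `(Δ ⊗ id)(F) F₁₂`. In
the first term `F` comes out on the left and cancels `F⁻¹`, which leaves `D(ξ) ⊗ 1`. In the second
the R-matrix passes `(Δ ⊗ id)(F)`, and `F⁻¹` absorbed as `(id ⊗ Δ)(F⁻¹)` gives `F₂₃` times `R̃₂₁` in
the first two legs. By the intertwining property this is `R̃₂ ⊗ ãd(R̃₁)(D(ξ))`. -/
lemma adMul_mem_LieSet {ξ : H} (hξ : ξ ∈ LieSet k H) :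
    adMul ξ Fv ∈ @LieSet k H _ _ F.twistedStructure := by
  have had : (((@ad k H _ _ F.twistedStructure.toHopfAlgebra).flip (adMul ξ Fv) : H →ₗ[k] H)) =
      adMul ξ ∘ₗ LinearMap.mulLeft k Fv ∘ₗ (TensorProduct.mk k H H).flip 1 := by
    refine LinearMap.ext fun h => (F.ad_twistedStructure h ξ).trans ?_
    simp [adMul_mul]
  have hF : onRight Δ Fi * onLeft Δ Fv = leg23 Fv * leg12 Fi := by
    have e (f : H ⊗[k] H →ₐ[k] H ⊗[k] (H ⊗[k] H)) : f Fi * f Fv = 1 := by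
      rw [← map_mul, Units.inv_mul, map_one]
    have e' : leg12 Fv * leg12 Fi = 1 := by rw [← map_mul, Units.mul_inv, map_one]
    calc onRight Δ Fi * onLeft Δ Fv
        = onRight Δ Fi * (onLeft Δ Fv * leg12 Fv) * leg12 Fi := by
          rw [mul_assoc, mul_assoc, e', mul_one]
      _ = _ := by rw [F.cocycle, ← mul_assoc, e, one_mul]
  have hR : Fi * flip (RR * Fv) = flip F.rMatrix := by
    rw [rMatrix, mul_assoc, map_mul flip (flip Fi), flip_flip]
  rw [mem_LieSet_twistedStructure_iff, had, ← adMulRight_leg23_mul_leg12, comul_apply, mul_assoc,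
    comul_adMul hξ, ← F.cocycle, ← mul_assoc (leg12 RR), map_mul swap12,
    swap12_leg12_mul_onLeft _ TriangularHopfAlgebra.R_mul_comul, swap12_leg12, mul_assoc,
    ← map_mul, ← map_mul, adMulLeft_onLeft, mul_add, ← mul_assoc, Units.inv_mul, one_mul,
    ← adMulRight_onRight, ← mul_assoc, hF, mul_assoc, ← map_mul, hR]

lemma adjoin_LieSet_twistedStructure (hgen : Algebra.adjoin k (LieSet k H) = ⊤) :
    Algebra.adjoin k (@LieSet k H _ _ F.twistedStructure) = ⊤ := by
  rw [eq_top_iff]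
  rintro a -
  obtain ⟨b, rfl⟩ := F.adMul_surjective a
  have hb : b ∈ Algebra.adjoin k (LieSet k H) := hgen ▸ Algebra.mem_top
  have halg (r : k) (h : H) : adMul (ad k h (algebraMap k H r)) Fv =
      algebraMap k H (r * Bialgebra.counitAlgHom k H h) := by
    rw [Algebra.algebraMap_eq_smul_one r, map_smul, ad_one_right, adMul_eq,
      Algebra.algebraMap_eq_smul_one, map_smul, map_smul, smul_mul_assoc, smul_mul_assoc,
      ← adMul_eq, adMul_one, smul_smul, Algebra.algebraMap_eq_smul_one]
  -- The quantifier over `h` is part of the induction: the product case needs the hypothesis at the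
  -- components of `F⁻¹ Δ(h)`.
  have main : ∀ h, adMul (ad k h b) Fv ∈
      Algebra.adjoin k (@LieSet k H _ _ F.twistedStructure) := by
    induction hb using Algebra.adjoin_induction with
    | mem x hx =>
      exact fun h => Algebra.subset_adjoin (F.adMul_mem_LieSet (ad_mem_LieSet hx h))
    | algebraMap r => exact fun h => halg r h ▸ Subalgebra.algebraMap_mem _ _
    | add x y _ _ hx hy =>
      intro h
      rw [map_add, adMul_eq, map_add, add_mul, ← adMul_eq, ← adMul_eq]
      exact Subalgebra.add_mem _ (hx h) (hy h)
    | mul x y _ _ hx hy => exact F.adMul_ad_mul_mem _ hx hy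
  have := main 1
  rwa [ad_one_left] at this

end Triangular

end TwistingCocycle

end HopfTwist

theorem mainTheorem10 {H : Type*} [Ring H] [HopfTwist.TriangularHopfAlgebra ℂ H]
    (F : HopfTwist.TwistingCocycle ℂ H)
    (hgen : Algebra.adjoin ℂ (HopfTwist.LieSet ℂ H) = ⊤) :
    Algebra.adjoin ℂ (HopfTwist.LieSet ℂ (HopfTwist.Twist F)) = ⊤ := by
  -- `Twist F` unfolds to `H` with `F.twistedStructure`, so the two statements agree by definition.
  exact F.adjoin_LieSet_twistedStructure hgen
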